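/- Let $K$ be $\mathbb R$ or $\mathbb C$. An affine deformation $(A,a)$ of 3-space, $P\mapsto AP+a$, with $A\in K^{3\times 3}$ and $a\in K^3$, is identified with a point of $K^{12}$. For $t\in K^3$ let $[t]_\times$ be the matrix of $u\mapsto t\times u$. The deformation is applied twice, and three images are taken by the calibrated camera $[I;0]$; so the third image is related to the first by the deformation $(A^2,Aa+a)$. An essential matrix of a pair of images is a nonzero $3\times 3$ matrix $E$ with $q'^{t}Eq=0$ for the images $q,q'$ of every point. Put $$E_{12}=[a]_\times A,\qquad E_{13}=[Aa+a]_\times A^2 .$$ For $A_0,C_0\in K^{3\times 3}$ and $a_0,c_0\in K^3$ let $X\subset\mathbb A^{10}_K$ be the variety in the unknowns $\alpha,\gamma,x,z\in K$, $v_1,v_3\in K^3$ defined by $$\begin{cases}(A_0+a_0v_1^t)a_0+\alpha a_0-\gamma c_0=0\\ \gamma(A_0+a_0v_1^t)^2-\alpha^2(C_0+c_0v_3^t)=0\\ \alpha x-1=0\\ \gamma z-1=0.\end{cases}$$ There is a nonzero polynomial $f$ in 12 variables with real coefficients such that, for $K=\mathbb R$ and for $K=\mathbb C$, every affine deformation $(A,a)$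 over $K$ with $f(A,a)\neq 0$ has the following properties. 1. The essential matrices of the first and second image are exactly the nonzero scalar multiples of $E_{12}$, and those of the first and third image are exactly the nonzero scalar multiples of $E_{13}$. 2. Whenever $[a_0]_\times A_0=E_{12}$ and $[c_0]_\times C_0=E_{13}$ (with the scale of the matrices $E_{12}$, $E_{13}$ as above), the variety $X$ has dimension zero (its coordinate ring $K[\alpha,\gamma,x,z,v_1,v_3]/I$, with $I$ generated by the equations of the system, has Krull dimension $0$), and $X$ has exactly one $K$-point. This point recovers the deformation: $$a=\alpha a_0,\quad A=\tfrac1\alpha(A_0+a_0v_1^t),\quad Aa+a=\gamma c_0,\quad A^2=\tfrac1\gamma(C_0+c_0v_3^t).$$ -/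

import Mathlib

open Matrix

/-- An affine deformation `P ↦ A P + a` of 3-space over `K`. -/
@[ext]
structure AffineDeformation (K : Type*) where
  A : Matrix (Fin 3) (Fin 3) K
  a : Fin 3 → K

namespace AffineDeformation

variable {K : Type*} [CommRing K]

/-- The composite `d' ∘ d`: first `d = (A, a)`, then `d' = (B, b)`, giving `(B A, B a + b)`. -/
def comp (d' d : AffineDeformation K) : AffineDeformation K where
  A := d'.A * d.A
  a := d'.A *ᵥ d.a + d'.a

/-- The `4 × 4` matrix `[[A, a], [0, 1]]` of a deformation in homogeneous coordinates. -/
def toMatrix (d : AffineDeformation K) : Matrix (Fin 3 ⊕ Unit) (Fin 3 ⊕ Unit) K :=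
  Matrix.fromBlocks d.A (Matrix.replicateCol Unit d.a) 0 1

theorem toMatrix_comp (d' d : AffineDeformation K) :
    (d'.comp d).toMatrix = d'.toMatrix * d.toMatrix := by
  simp only [toMatrix, comp, Matrix.fromBlocks_multiply]
  congr 1 <;> ext i j <;> simp [Matrix.mul_apply, Matrix.mulVec, dotProduct]

/-- The twelve coordinates of a deformation, which identify the space of deformations with
affine 12-space. -/
def coords (d : AffineDeformation K) : (Fin 3 × Fin 3) ⊕ Fin 3 → K :=
  Sum.elim (fun p => d.A p.1 p.2) d.a

end AffineDeformation

/-- The calibrated camera `[I; 0]`, a `3 × 4` matrix. -/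
def calibratedCamera (K : Type*) [CommRing K] : Matrix (Fin 3) (Fin 3 ⊕ Unit) K :=
  Matrix.fromCols 1 0

/-- The matrix `[t]_×` of `u ↦ t × u` in the standard basis. -/
def crossMatrix {K : Type*} [CommRing K] (t : Fin 3 → K) : Matrix (Fin 3) (Fin 3) K :=
  !![0, -t 2, t 1; t 2, 0, -t 0; -t 1, t 0, 0]

theorem crossMatrix_mulVec {K : Type*} [CommRing K] (t u : Fin 3 → K) :
    crossMatrix t *ᵥ u = crossProduct t u := by
  ext i
  fin_cases i <;> simp [crossMatrix, cross_apply, Matrix.mulVec, dotProduct, Fin.sum_univ_three]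
    <;> ring

/-- `E` is an essential matrix of the pair of images, taken by the calibrated camera, before and
after the deformation `d`: it is nonzero and `q'ᵗ E q = 0` for the two images
`q = [I; 0] P` and `q' = [I; 0] d(P)` of every point `P`, in homogeneous coordinates. -/
def IsEssentialMatrix {K : Type*} [CommRing K] (d : AffineDeformation K)
    (E : Matrix (Fin 3) (Fin 3) K) : Prop :=
  E ≠ 0 ∧ ∀ P : Fin 3 ⊕ Unit → K,
    (calibratedCamera K *ᵥ (d.toMatrix *ᵥ P)) ⬝ᵥ (E *ᵥ (calibratedCamera K *ᵥ P)) = 0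

/-- The matrix `[a]_× A` attached to the deformation `(A, a)`. -/
def essentialMatrix {K : Type*} [CommRing K] (d : AffineDeformation K) :
    Matrix (Fin 3) (Fin 3) K :=
  crossMatrix d.a * d.A

/-- The ten unknowns `α, γ, x, z, v₁, v₃` (with `v₁, v₃` vectors of length three). -/
inductive Unknown
  | alpha
  | gamma
  | x
  | z
  | v₁ (i : Fin 3)
  | v₃ (i : Fin 3)

namespace RepeatedSystem

open MvPolynomial

variable {K : Type*} [CommRing K]

/-- The matrix `A₀ + a₀ v₁ᵗ` over the polynomial ring in the unknowns. -/
noncomputable def polyM (A₀ : Matrix (Fin 3) (Fin 3) K) (a₀ : Fin 3 → K) :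
    Matrix (Fin 3) (Fin 3) (MvPolynomial Unknown K) :=
  A₀.map C + vecMulVec (fun i => C (a₀ i)) (fun i => X (Unknown.v₁ i))

/-- The vector `(A₀ + a₀ v₁ᵗ) a₀ + α a₀ - γ c₀`. -/
noncomputable def vectorEq (A₀ : Matrix (Fin 3) (Fin 3) K) (a₀ c₀ : Fin 3 → K) :
    Fin 3 → MvPolynomial Unknown K :=
  polyM A₀ a₀ *ᵥ (fun i => C (a₀ i)) + (X Unknown.alpha : MvPolynomial Unknown K) •
    (fun i => C (a₀ i)) - (X Unknown.gamma : MvPolynomial Unknown K) • (fun i => C (c₀ i))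

/-- The matrix `γ (A₀ + a₀ v₁ᵗ)² - α² (C₀ + c₀ v₃ᵗ)`. -/
noncomputable def matrixEq (A₀ : Matrix (Fin 3) (Fin 3) K) (a₀ : Fin 3 → K)
    (C₀ : Matrix (Fin 3) (Fin 3) K) (c₀ : Fin 3 → K) :
    Matrix (Fin 3) (Fin 3) (MvPolynomial Unknown K) :=
  (X Unknown.gamma : MvPolynomial Unknown K) • (polyM A₀ a₀) ^ 2 -
    (X Unknown.alpha : MvPolynomial Unknown K) ^ 2 •
      (C₀.map C + vecMulVec (fun i => C (c₀ i)) (fun i => X (Unknown.v₃ i)))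

/-- All polynomials of the system: the entries of the vector and of the matrix equation, and the
localization equations `α x - 1` and `γ z - 1`. -/
noncomputable def equations (A₀ : Matrix (Fin 3) (Fin 3) K) (a₀ : Fin 3 → K)
    (C₀ : Matrix (Fin 3) (Fin 3) K) (c₀ : Fin 3 → K) : Set (MvPolynomial Unknown K) :=
  Set.range (vectorEq A₀ a₀ c₀) ∪
    Set.range (fun p : Fin 3 × Fin 3 => matrixEq A₀ a₀ C₀ c₀ p.1 p.2) ∪
    {X Unknown.alpha * X Unknown.x - 1, X Unknown.gamma * X Unknown.z - 1}

/-- The `K`-points of the subvariety `X` of affine 10-space defined by the system. -/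
def solutions (A₀ : Matrix (Fin 3) (Fin 3) K) (a₀ : Fin 3 → K)
    (C₀ : Matrix (Fin 3) (Fin 3) K) (c₀ : Fin 3 → K) : Set (Unknown → K) :=
  {p | ∀ f ∈ equations A₀ a₀ C₀ c₀, eval p f = 0}

/-- The coordinate ring of `X`. -/
abbrev coordinateRing (A₀ : Matrix (Fin 3) (Fin 3) K) (a₀ : Fin 3 → K)
    (C₀ : Matrix (Fin 3) (Fin 3) K) (c₀ : Fin 3 → K) : Type _ :=
  MvPolynomial Unknown K ⧸ Ideal.span (equations A₀ a₀ C₀ c₀)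

end RepeatedSystem

/-- The deformation `d = (A, a)`, applied twice, is uniquely recovered from its three images:
* the essential matrices of the image pairs `(1,2)` and `(1,3)` are, up to a nonzero scalar,
  `E₁₂ = [a]_× A` and `E₁₃ = [A a + a]_× A²`;
* for all factorizations `E₁₂ = [a₀]_× A₀` and `E₁₃ = [c₀]_× C₀`, the variety `X` of the system
  has dimension zero and exactly one point, and this point gives back `(A, a)` and its square. -/
def UniquelyRecovered {K : Type*} [Field K] (d : AffineDeformation K) : Prop :=
  (∀ E, IsEssentialMatrix d E ↔ ∃ c : K, c ≠ 0 ∧ E = c • essentialMatrix d) ∧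
  (∀ E, IsEssentialMatrix (d.comp d) E ↔
    ∃ c : K, c ≠ 0 ∧ E = c • essentialMatrix (d.comp d)) ∧
  ∀ (A₀ : Matrix (Fin 3) (Fin 3) K) (a₀ : Fin 3 → K)
    (C₀ : Matrix (Fin 3) (Fin 3) K) (c₀ : Fin 3 → K),
    crossMatrix a₀ * A₀ = essentialMatrix d →
    crossMatrix c₀ * C₀ = essentialMatrix (d.comp d) →
    ringKrullDim (RepeatedSystem.coordinateRing A₀ a₀ C₀ c₀) = 0 ∧
    ∃ p : Unknown → K, RepeatedSystem.solutions A₀ a₀ C₀ c₀ = {p} ∧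
      d.a = p .alpha • a₀ ∧
      d.A = (p .alpha)⁻¹ • (A₀ + vecMulVec a₀ (fun i => p (.v₁ i))) ∧
      (d.comp d).a = p .gamma • c₀ ∧
      (d.comp d).A = (p .gamma)⁻¹ • (C₀ + vecMulVec c₀ (fun i => p (.v₃ i)))

/-! An essential matrix `[a]_× A` determines `a` up to a scale `α`, and `α A` up to a rank-one term
`a₀ vᵗ`. Hence the true deformation gives a point of `X`, and the issue is its uniqueness. Rescaled
by the true values, any other point replaces `A` by `A + a wᵗ`, with ratios `s`, `g` of the scales
`α`, `γ` and a vector `y` from `v₃`. As `a` and `A a` are independent, the vector equation gives `g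
= 1` and `w · a = 1 - s`. The matrix equation modulo the span of `a` and `A a` gives `s² = 1`; its
coefficients on these vectors give `y = w` and `wᵗ A = s wᵗ`. So `wᵗ (A² - 1) = 0`, whence `w = 0`
and `s = 1` (`IsRegularDeformation.rigid`). The argument divides only by units, so it holds over
every `K`-algebra. Applied to the tautological point over the coordinate ring, it shows that this
ring is `K`, hence of dimension zero. -/

/-- The open conditions on `(A, a)` under which the deformation is uniquely recovered: `A` is
invertible, `±1` are not eigenvalues of `A`, and `a`, `A a` are independent, as witnessed by the
first coordinate of their cross product. -/
structure IsRegularDeformation {R : Type*} [CommRing R] (A : Matrix (Fin 3) (Fin 3) R)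
    (a : Fin 3 → R) : Prop where
  isUnit_det : IsUnit A.det
  isUnit_det_sq_sub_one : IsUnit (A ^ 2 - 1).det
  isUnit_cross : IsUnit (crossProduct a (A *ᵥ a) 0)

/-! ### Rigidity of the system over commutative rings -/

section CommRing

variable {R : Type*} [CommRing R]

/-- Cramer's rule on the last two coordinates, whose minor is the given unit; no absence of zero
divisors is needed. -/
theorem eq_zero_of_smul_add_smul_eq_zero {a b : Fin 3 → R} (h : IsUnit (crossProduct a b 0))
    {p q : R} (e : p • a + q • b = 0) : p = 0 ∧ q = 0 := by
  have e1 := congrFun e 1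
  have e2 := congrFun e 2
  simp only [Pi.add_apply, Pi.smul_apply, smul_eq_mul, Pi.zero_apply] at e1 e2
  have hn : crossProduct a b 0 = a 1 * b 2 - a 2 * b 1 := by simp [cross_apply]
  rw [hn] at h
  constructor
  · apply (h.mul_left_eq_zero).1
    linear_combination b 2 * e1 - b 1 * e2
  · apply (h.mul_left_eq_zero).1
    linear_combination a 1 * e2 - a 2 * e1

theorem exists_mulVec_eq {B : Matrix (Fin 3) (Fin 3) R} (h : IsUnit B.det) (v : Fin 3 → R) :
    ∃ u, B *ᵥ u = v :=
  ⟨B⁻¹ *ᵥ v, by rw [mulVec_mulVec, mul_nonsing_inv _ h, one_mulVec]⟩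

theorem vecMulVec_mulVec_eq_smul (a w u : Fin 3 → R) : vecMulVec a w *ᵥ u = (w ⬝ᵥ u) • a := by
  rw [vecMulVec_mulVec, op_smul_eq_smul]

theorem eq_of_forall_dotProduct_eq {v w : Fin 3 → R} (h : ∀ u, v ⬝ᵥ u = w ⬝ᵥ u) : v = w := by
  ext i
  simpa using h (Pi.single i 1)

/-- Rigidity in normalized form: a rank-one perturbation `A + a wᵗ` whose square agrees with `A²`
up to scale and a rank-one term in the direction `A a + a`, compatibly with the translation
part, is trivial. -/
theorem IsRegularDeformation.rigid {A : Matrix (Fin 3) (Fin 3) R} {a : Fin 3 → R}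
    (h : IsRegularDeformation A a) {s g : R} {w y : Fin 3 → R}
    (h₁ : (A + vecMulVec a w) *ᵥ a + s • a = g • (A *ᵥ a + a))
    (h₂ : g • (A + vecMulVec a w) ^ 2 = s ^ 2 • (A ^ 2 + vecMulVec (A *ᵥ a + a) y)) :
    g = 1 ∧ s = 1 ∧ w = 0 ∧ y = 0 := by
  rw [add_mulVec, vecMulVec_mulVec_eq_smul] at h₁
  obtain ⟨hs, hg⟩ := eq_zero_of_smul_add_smul_eq_zero h.isUnit_cross
    (p := w ⬝ᵥ a + s - g) (q := 1 - g) (by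
      ext i
      have e := congrFun h₁ i
      simp only [Pi.add_apply, Pi.smul_apply, smul_eq_mul, Pi.zero_apply] at e ⊢
      linear_combination e)
  obtain rfl : g = 1 := by linear_combination -hg
  have key : ∀ u, (1 - s ^ 2) • (A *ᵥ (A *ᵥ u)) + ((w ⬝ᵥ u - s ^ 2 * (y ⬝ᵥ u)) • (A *ᵥ a) +
      (w ⬝ᵥ (A *ᵥ u) + (w ⬝ᵥ u) * (1 - s) - s ^ 2 * (y ⬝ᵥ u)) • a) = 0 := by
    intro u
    have e := congrArg (· *ᵥ u) h₂
    simp only [one_smul, smul_mulVec, pow_two, ← mulVec_mulVec, add_mulVec, mulVec_add,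
      vecMulVec_mulVec_eq_smul, mulVec_smul] at e
    have hwa : w ⬝ᵥ a = 1 - s := by linear_combination hs
    rw [hwa] at e
    ext i
    have ei := congrFun e i
    simp only [Pi.add_apply, Pi.smul_apply, smul_eq_mul, Pi.zero_apply] at ei ⊢
    linear_combination ei
  have hs2 : 1 - s ^ 2 = 0 := by
    -- With `A² u` the first basis vector, pairing with `a × A a` kills the other terms and leaves
    -- `1 - s²` times a unit.
    obtain ⟨u', hu'⟩ := exists_mulVec_eq h.isUnit_det (Pi.single 0 1)
    obtain ⟨u, rfl⟩ := exists_mulVec_eq h.isUnit_det u'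
    have e := congrArg (crossProduct a (A *ᵥ a) ⬝ᵥ ·) (key u)
    simp only [dotProduct_add, dotProduct_smul, dotProduct_comm _ (A *ᵥ a), dotProduct_comm _ a,
      dot_self_cross, dot_cross_self, hu', dotProduct_single_one, dotProduct_zero,
      mul_zero, add_zero, smul_eq_mul] at e
    exact h.isUnit_cross.mul_left_eq_zero.1 e
  have hcoef : ∀ u, y ⬝ᵥ u = w ⬝ᵥ u ∧ w ⬝ᵥ (A *ᵥ u) = s * (w ⬝ᵥ u) := by
    intro u
    have e := key u
    rw [hs2, zero_smul, zero_add, add_comm] at e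
    obtain ⟨e₁, e₂⟩ := eq_zero_of_smul_add_smul_eq_zero h.isUnit_cross e
    constructor
    · linear_combination -e₂ + (y ⬝ᵥ u) * hs2
    · linear_combination e₁ - e₂
  have hw : w = 0 := by
    apply eq_of_forall_dotProduct_eq
    intro v
    obtain ⟨u, rfl⟩ := exists_mulVec_eq h.isUnit_det_sq_sub_one v
    rw [sub_mulVec, one_mulVec, pow_two, ← mulVec_mulVec, dotProduct_sub, (hcoef _).2,
      (hcoef _).2, zero_dotProduct]
    linear_combination -(w ⬝ᵥ u) * hs2
  subst hw
  refine ⟨rfl, ?_, rfl, eq_of_forall_dotProduct_eq fun u => (hcoef u).1⟩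
  rw [zero_dotProduct] at hs
  linear_combination hs

theorem inv_smul_eq_of_eq_smul {α x : R} {a b : Fin 3 → R} (hx : α * x = 1) (h : a = α • b) :
    b = x • a := by
  rw [h, smul_smul, mul_comm, hx, one_smul]

/-- Over any commutative ring, the system of a regular deformation has only one solution. -/
theorem IsRegularDeformation.solution_unique {A A₀ C₀ : Matrix (Fin 3) (Fin 3) R}
    {a a₀ c₀ : Fin 3 → R} (h : IsRegularDeformation A a)
    {α γ x z α' γ' x' z' : R} {v₁ v₃ v₁' v₃' : Fin 3 → R}
    (ha : a = α • a₀) (hA : α • A = A₀ + vecMulVec a₀ v₁)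
    (hc : A *ᵥ a + a = γ • c₀) (hC : γ • A ^ 2 = C₀ + vecMulVec c₀ v₃)
    (hx : α * x = 1) (hz : γ * z = 1)
    (h₁ : (A₀ + vecMulVec a₀ v₁') *ᵥ a₀ + α' • a₀ - γ' • c₀ = 0)
    (h₂ : γ' • (A₀ + vecMulVec a₀ v₁') ^ 2 - α' ^ 2 • (C₀ + vecMulVec c₀ v₃') = 0)
    (hx' : α' * x' = 1) (hz' : γ' * z' = 1) :
    α' = α ∧ γ' = γ ∧ x' = x ∧ z' = z ∧ v₁' = v₁ ∧ v₃' = v₃ := by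
  have ha₀ := inv_smul_eq_of_eq_smul hx ha
  have hc₀ := inv_smul_eq_of_eq_smul hz hc
  -- One factor `x` comes from `a₀ = x a`, the other from pulling out `α`.
  have hM : A₀ + vecMulVec a₀ v₁' = α • (A + vecMulVec a (x ^ 2 • (v₁' - v₁))) := by
    rw [smul_add, hA, ha₀]
    ext i j
    simp only [Matrix.add_apply, Matrix.smul_apply, vecMulVec_apply, Pi.smul_apply, Pi.sub_apply, smul_eq_mul]
    linear_combination (-x * a i * (v₁' j - v₁ j)) * hx
  have hN : C₀ + vecMulVec c₀ v₃' =
      γ • (A ^ 2 + vecMulVec (A *ᵥ a + a) (z ^ 2 • (v₃' - v₃))) := by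
    rw [smul_add, hC, hc₀]
    ext i j
    simp only [Matrix.add_apply, Matrix.smul_apply, vecMulVec_apply, Pi.smul_apply, Pi.sub_apply, smul_eq_mul,
      Pi.add_apply]
    linear_combination (-z * ((A *ᵥ a) i + a i) * (v₃' j - v₃ j)) * hz
  rw [hM, hc₀, ha₀, sub_eq_zero] at h₁
  rw [hM, hN, sub_eq_zero] at h₂
  generalize hw : x ^ 2 • (v₁' - v₁) = w at h₁ h₂
  generalize hy : z ^ 2 • (v₃' - v₃) = y at h₂
  obtain ⟨hg, hs, hw0, hy0⟩ := h.rigid (s := α' * x) (g := γ' * z) (w := w) (y := y)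
    (by
      rw [smul_mulVec, mulVec_smul, smul_smul, hx, one_smul, smul_smul, smul_smul] at h₁
      exact h₁)
    (by
      have e := congrArg ((x ^ 2 * z) • ·) h₂
      simp only [smul_pow, smul_smul] at e
      have e₁ : x ^ 2 * z * (γ' * α ^ 2) = γ' * z := by
        linear_combination (z * γ' * (α * x + 1)) * hx
      have e₂ : x ^ 2 * z * (α' ^ 2 * γ) = (α' * x) ^ 2 := by
        linear_combination (x ^ 2 * α' ^ 2) * hz
      rwa [e₁, e₂] at e)
  have hα : α' = α := by linear_combination α * hs - α' * hx
  have hγ : γ' = γ := by linear_combination γ * hg - γ' * hz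
  subst hα hγ hw0 hy0
  refine ⟨rfl, rfl, ?_, ?_, ?_, ?_⟩
  · linear_combination x * hx' - x' * hx
  · linear_combination z * hz' - z' * hz
  · ext i
    have e := congrFun hw i
    simp only [Pi.smul_apply, Pi.sub_apply, smul_eq_mul, Pi.zero_apply] at e
    linear_combination α' ^ 2 * e - ((v₁' i - v₁ i) * (α' * x + 1)) * hx
  · ext i
    have e := congrFun hy i
    simp only [Pi.smul_apply, Pi.sub_apply, smul_eq_mul, Pi.zero_apply] at e
    linear_combination γ' ^ 2 * e - ((v₃' i - v₃ i) * (γ' * z + 1)) * hz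

end CommRing

/-! ### Essential matrices and their factorizations -/

section Field

variable {K : Type*} [Field K]

theorem exists_eq_smul_of_cross_eq_zero {a u : Fin 3 → K} (ha : a ≠ 0)
    (h : crossProduct a u = 0) : ∃ c : K, u = c • a := by
  obtain ⟨i, hi⟩ := Function.ne_iff.1 ha
  rw [Pi.zero_apply] at hi
  have e0 := congrFun h 0
  have e1 := congrFun h 1
  have e2 := congrFun h 2
  simp [cross_apply] at e0 e1 e2
  refine ⟨u i / a i, ?_⟩
  ext j
  rw [Pi.smul_apply, smul_eq_mul, div_mul_eq_mul_div, eq_div_iff hi]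
  fin_cases i <;> fin_cases j <;> simp <;> grind

theorem crossMatrix_eq_zero {a : Fin 3 → K} (h : crossMatrix a = 0) : a = 0 := by
  ext i
  fin_cases i
  · simpa [crossMatrix] using congrFun (congrFun h 2) 1
  · simpa [crossMatrix] using congrFun (congrFun h 0) 2
  · simpa [crossMatrix] using congrFun (congrFun h 1) 0

/-- Every matrix with `a` in its left kernel and alternating as a bilinear form is a multiple of
`[a]_×`. -/
theorem exists_eq_smul_crossMatrix {a : Fin 3 → K} (ha : a ≠ 0) {S : Matrix (Fin 3) (Fin 3) K}
    (halt : ∀ v, v ⬝ᵥ (S *ᵥ v) = 0) (hker : ∀ v, a ⬝ᵥ (S *ᵥ v) = 0) :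
    ∃ c : K, S = c • crossMatrix a := by
  have e0 := halt ![1, 0, 0]
  have e1 := halt ![0, 1, 0]
  have e2 := halt ![0, 0, 1]
  have e01 := halt ![1, 1, 0]
  have e02 := halt ![1, 0, 1]
  have e12 := halt ![0, 1, 1]
  have k0 := hker ![1, 0, 0]
  have k1 := hker ![0, 1, 0]
  have k2 := hker ![0, 0, 1]
  simp [dotProduct, mulVec, Fin.sum_univ_three] at e0 e1 e2 e01 e02 e12 k0 k1 k2
  -- The alternating matrix `S` is `[t]_×` for this vector `t`, and the left kernel condition says
  -- `a × t = 0`.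
  obtain ⟨c, hc⟩ := exists_eq_smul_of_cross_eq_zero (u := ![S 2 1, S 0 2, S 1 0]) ha (by
    ext i
    fin_cases i <;> simp [cross_apply] <;> grind)
  have c0 := congrFun hc 0
  have c1 := congrFun hc 1
  have c2 := congrFun hc 2
  simp at c0 c1 c2
  refine ⟨c, ?_⟩
  ext i j
  fin_cases i <;> fin_cases j <;> simp [crossMatrix] <;> grind

/-- The camera drops the last homogeneous coordinate `l`, which scales the translation independently
of `q`. -/
theorem isEssentialMatrix_iff_forall (d : AffineDeformation K) (E : Matrix (Fin 3) (Fin 3) K) :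
    IsEssentialMatrix d E ↔
      E ≠ 0 ∧ ∀ (q : Fin 3 → K) (l : K), (d.A *ᵥ q + l • d.a) ⬝ᵥ (E *ᵥ q) = 0 := by
  have hcam : ∀ P : Fin 3 ⊕ Unit → K, calibratedCamera K *ᵥ P = P ∘ Sum.inl := by
    intro P
    simp [calibratedCamera, fromCols_mulVec]
  have hcol : ∀ v : Unit → K, replicateCol Unit d.a *ᵥ v = v () • d.a := by
    intro v
    ext i
    simp [mulVec, dotProduct, mul_comm]
  have hmat : ∀ P : Fin 3 ⊕ Unit → K,
      (d.toMatrix *ᵥ P) ∘ Sum.inl = d.A *ᵥ (P ∘ Sum.inl) + P (Sum.inr ()) • d.a := by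
    intro P
    simp [AffineDeformation.toMatrix, fromBlocks_mulVec, hcol]
  simp only [IsEssentialMatrix, hcam, hmat]
  refine and_congr_right fun _ => ⟨fun h q l => ?_, fun h P => h _ _⟩
  simpa using h (Sum.elim q fun _ => l)

/-- The cases `l = 0` and `l = 1` make `E A⁻¹` alternating with `a` in its left kernel, hence a
multiple of `[a]_×`. -/
theorem isEssentialMatrix_iff {d : AffineDeformation K} (hA : IsUnit d.A.det) (ha : d.a ≠ 0)
    (E : Matrix (Fin 3) (Fin 3) K) :
    IsEssentialMatrix d E ↔ ∃ c : K, c ≠ 0 ∧ E = c • essentialMatrix d := by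
  rw [isEssentialMatrix_iff_forall]
  constructor
  · rintro ⟨hE, h⟩
    have halt : ∀ q, (d.A *ᵥ q) ⬝ᵥ (E *ᵥ q) = 0 := fun q => by simpa using h q 0
    have hker : ∀ q, d.a ⬝ᵥ (E *ᵥ q) = 0 := fun q => by
      simpa [add_dotProduct, halt] using h q 1
    have hAA : ∀ v, d.A *ᵥ (d.A⁻¹ *ᵥ v) = v := fun v => by
      rw [mulVec_mulVec, mul_nonsing_inv _ hA, one_mulVec]
    obtain ⟨c, hc⟩ := exists_eq_smul_crossMatrix ha (S := E * d.A⁻¹)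
      (fun v => by
        have e := halt (d.A⁻¹ *ᵥ v)
        rwa [hAA, mulVec_mulVec] at e)
      (fun v => by rw [← mulVec_mulVec, hker])
    have hEc : E = c • essentialMatrix d := by
      rw [essentialMatrix, ← Matrix.smul_mul, ← hc, nonsing_inv_mul_cancel_right _ _ hA]
    refine ⟨c, ?_, hEc⟩
    rintro rfl
    exact hE (by rw [hEc, zero_smul])
  · rintro ⟨c, hc, rfl⟩
    constructor
    · intro h0
      apply ha
      apply crossMatrix_eq_zero
      have e := (smul_eq_zero.1 h0).resolve_left hc
      rw [← mul_nonsing_inv_cancel_right _ (crossMatrix d.a) hA]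
      rw [essentialMatrix] at e
      rw [e, Matrix.zero_mul]
    · intro q l
      rw [smul_mulVec, essentialMatrix, ← mulVec_mulVec, crossMatrix_mulVec, dotProduct_smul,
        add_dotProduct, smul_dotProduct, dot_self_cross, dot_cross_self]
      simp

/-- Two factorizations `[a₀]_× A₀ = [a]_× A` differ by a scalar and a rank-one matrix. -/
theorem exists_factorization {A A₀ : Matrix (Fin 3) (Fin 3) K} {a a₀ : Fin 3 → K}
    (hA : IsUnit A.det) (ha : a ≠ 0) (h : crossMatrix a₀ * A₀ = crossMatrix a * A) :
    ∃ (α : K) (v : Fin 3 → K), α ≠ 0 ∧ a = α • a₀ ∧ α • A = A₀ + vecMulVec a₀ v := by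
  have hv : ∀ u, crossProduct a₀ (A₀ *ᵥ u) = crossProduct a (A *ᵥ u) := by
    intro u
    rw [← crossMatrix_mulVec, ← crossMatrix_mulVec, mulVec_mulVec, mulVec_mulVec, h]
  have ha₀ : a₀ ≠ 0 := by
    rintro rfl
    apply ha
    apply crossMatrix_eq_zero
    rw [← mul_nonsing_inv_cancel_right _ (crossMatrix a) hA, ← h]
    have : crossMatrix (0 : Fin 3 → K) = 0 := by
      ext i j
      fin_cases i <;> fin_cases j <;> simp [crossMatrix]
    rw [this, Matrix.zero_mul, Matrix.zero_mul]
  -- Every vector is some `A u`, and `A u · (a₀ × a) = a₀ · (a × A u) = a₀ · (a₀ × A₀ u) = 0`.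
  have hcross : crossProduct a₀ a = 0 := by
    apply eq_of_forall_dotProduct_eq
    intro v
    obtain ⟨u, rfl⟩ := exists_mulVec_eq hA v
    rw [zero_dotProduct, dotProduct_comm, triple_product_permutation, ← hv, dot_self_cross]
  obtain ⟨α, hα⟩ := exists_eq_smul_of_cross_eq_zero ha₀ hcross
  have hcol : ∀ j, ∃ c : K, (α • A - A₀) *ᵥ Pi.single j 1 = c • a₀ := by
    intro j
    apply exists_eq_smul_of_cross_eq_zero ha₀
    rw [sub_mulVec, map_sub, hv, hα, smul_mulVec, map_smul, map_smul, LinearMap.smul_apply,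
      sub_self]
  choose v hv' using hcol
  refine ⟨α, v, ?_, hα, ?_⟩
  · rintro rfl
    exact ha (by rw [hα, zero_smul])
  · ext i j
    have e := congrFun (hv' j) i
    simp only [mulVec_single_one, Matrix.col_apply, Matrix.sub_apply, Matrix.smul_apply,
      Pi.smul_apply, smul_eq_mul] at e
    simp only [Matrix.add_apply, Matrix.smul_apply, vecMulVec_apply, smul_eq_mul]
    linear_combination e

end Field

/-! ### Base change and the coordinate ring -/

theorem IsRegularDeformation.map {R S : Type*} [CommRing R] [CommRing S]
    {A : Matrix (Fin 3) (Fin 3) R} {a : Fin 3 → R} (h : IsRegularDeformation A a) (φ : R →+* S) :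
    IsRegularDeformation (A.map φ) (φ ∘ a) where
  isUnit_det := by
    have e := h.isUnit_det.map φ
    rwa [RingHom.map_det] at e
  isUnit_det_sq_sub_one := by
    have e := h.isUnit_det_sq_sub_one.map φ
    rwa [RingHom.map_det, map_sub, map_pow, map_one] at e
  isUnit_cross := by
    have e := h.isUnit_cross.map φ
    have hcross : crossProduct (φ ∘ a) (A.map φ *ᵥ (φ ∘ a)) 0 =
        φ (crossProduct a (A *ᵥ a) 0) := by
      simp [cross_apply, mulVec, dotProduct]
    rwa [hcross]

theorem Matrix.map_add_vecMulVec {R S : Type*} [CommRing R] [CommRing S] (φ : R →+* S)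
    (M : Matrix (Fin 3) (Fin 3) R) (a v : Fin 3 → R) :
    (M + vecMulVec a v).map φ = M.map φ + vecMulVec (φ ∘ a) (φ ∘ v) := by
  ext i j
  simp [vecMulVec_apply]

namespace RepeatedSystem

open MvPolynomial

section

variable {K R : Type*} [CommRing K] [CommRing R] [Algebra K R]

/-- A point with coordinates in a `K`-algebra satisfies all equations of the system if and only if
it satisfies the system in its matrix form. -/
theorem forall_aeval_eq_zero_iff (A₀ : Matrix (Fin 3) (Fin 3) K) (a₀ : Fin 3 → K)
    (C₀ : Matrix (Fin 3) (Fin 3) K) (c₀ : Fin 3 → K) (r : Unknown → R) :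
    (∀ f ∈ equations A₀ a₀ C₀ c₀, aeval r f = 0) ↔
      (A₀.map (algebraMap K R) + vecMulVec (algebraMap K R ∘ a₀) fun i => r (.v₁ i)) *ᵥ
          (algebraMap K R ∘ a₀) + r .alpha • (algebraMap K R ∘ a₀) -
          r .gamma • (algebraMap K R ∘ c₀) = 0 ∧
      r .gamma • (A₀.map (algebraMap K R) +
          vecMulVec (algebraMap K R ∘ a₀) fun i => r (.v₁ i)) ^ 2 -
          r .alpha ^ 2 • (C₀.map (algebraMap K R) +
            vecMulVec (algebraMap K R ∘ c₀) fun i => r (.v₃ i)) = 0 ∧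
      r .alpha * r .x = 1 ∧ r .gamma * r .z = 1 := by
  have hM : (polyM A₀ a₀).map (aeval r) =
      A₀.map (algebraMap K R) + vecMulVec (algebraMap K R ∘ a₀) fun i => r (.v₁ i) := by
    ext i j
    simp [polyM, vecMulVec_apply]
  have hV : (fun i => aeval r (vectorEq A₀ a₀ c₀ i)) =
      (A₀.map (algebraMap K R) + vecMulVec (algebraMap K R ∘ a₀) fun i => r (.v₁ i)) *ᵥ
          (algebraMap K R ∘ a₀) + r .alpha • (algebraMap K R ∘ a₀) -
          r .gamma • (algebraMap K R ∘ c₀) := by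
    rw [← hM]
    ext i
    simp [vectorEq, mulVec, dotProduct]
  have hE : (matrixEq A₀ a₀ C₀ c₀).map (aeval r) =
      r .gamma • (A₀.map (algebraMap K R) +
          vecMulVec (algebraMap K R ∘ a₀) fun i => r (.v₁ i)) ^ 2 -
          r .alpha ^ 2 • (C₀.map (algebraMap K R) +
            vecMulVec (algebraMap K R ∘ c₀) fun i => r (.v₃ i)) := by
    rw [← hM]
    ext i j
    simp [matrixEq, pow_two, Matrix.mul_apply, vecMulVec_apply]
  rw [← hV, ← hE]
  constructor
  · intro h
    refine ⟨funext fun i => h _ (.inl (.inl ⟨i, rfl⟩)), ?_, ?_, ?_⟩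
    · ext i j
      exact h _ (.inl (.inr ⟨(i, j), rfl⟩))
    · simpa [sub_eq_zero] using h _ (.inr (.inl rfl))
    · simpa [sub_eq_zero] using h _ (.inr (.inr rfl))
  · rintro ⟨h₁, h₂, h₃, h₄⟩ f ((⟨i, rfl⟩ | ⟨⟨i, j⟩, rfl⟩) | rfl | rfl)
    · exact congrFun h₁ i
    · exact congrFun (congrFun h₂ i) j
    · simp [h₃]
    · simp [h₄]

end

/-- If a `K`-point of the system is its only point over every `K`-algebra, then the coordinate
ring is `K` and has Krull dimension zero. -/
theorem ringKrullDim_coordinateRing_eq_zero {K : Type*} [Field K]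
    {A₀ : Matrix (Fin 3) (Fin 3) K} {a₀ : Fin 3 → K}
    {C₀ : Matrix (Fin 3) (Fin 3) K} {c₀ : Fin 3 → K} {p : Unknown → K}
    (hp : p ∈ solutions A₀ a₀ C₀ c₀)
    (huniq : ∀ r : Unknown → coordinateRing A₀ a₀ C₀ c₀,
      (∀ f ∈ equations A₀ a₀ C₀ c₀, aeval r f = 0) → r = fun i => algebraMap K _ (p i)) :
    ringKrullDim (coordinateRing A₀ a₀ C₀ c₀) = 0 := by
  let I := Ideal.span (equations A₀ a₀ C₀ c₀)
  have hmk : ∀ f, aeval (fun i => Ideal.Quotient.mk I (X i)) f = Ideal.Quotient.mk I f := by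
    intro f
    have e := congrArg (· f) (aeval_unique (Ideal.Quotient.mkₐ K I))
    exact e.symm
  -- The classes of the variables form the tautological point; uniqueness makes them constants.
  have hX : (fun i => Ideal.Quotient.mk I (X i)) = fun i => algebraMap K _ (p i) :=
    huniq _ fun f hf => by
      rw [hmk, Ideal.Quotient.eq_zero_iff_mem]
      exact Ideal.subset_span hf
  have hsurj : Function.Surjective (algebraMap K (coordinateRing A₀ a₀ C₀ c₀)) := by
    intro y
    obtain ⟨f, rfl⟩ := Ideal.Quotient.mk_surjective y
    refine ⟨eval p f, ?_⟩
    have e := hmk f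
    rw [hX] at e
    rw [← e, ← aeval_eq_eval p]
    exact (aeval_algebraMap_apply _ p f).symm
  have hI : I ≤ RingHom.ker (eval p) := Ideal.span_le.2 fun f hf => hp f hf
  have hne : I ≠ ⊤ := fun h => RingHom.ker_ne_top (eval p) (top_le_iff.1 (h ▸ hI))
  have : Nontrivial (coordinateRing A₀ a₀ C₀ c₀) := Ideal.Quotient.nontrivial_iff.2 hne
  rw [← ringKrullDim_eq_of_ringEquiv
    (RingEquiv.ofBijective (algebraMap K _) ⟨(algebraMap K _).injective, hsurj⟩)]
  exact ringKrullDim_eq_zero_of_field K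

end RepeatedSystem

/-! ### Recovery of regular deformations -/

/-- The point of affine 10-space with the given coordinates. -/
def Unknown.point {K : Type*} (α γ x z : K) (v₁ v₃ : Fin 3 → K) : Unknown → K
  | .alpha => α
  | .gamma => γ
  | .x => x
  | .z => z
  | .v₁ i => v₁ i
  | .v₃ i => v₃ i

theorem IsRegularDeformation.uniquelyRecovered {K : Type*} [Field K] {d : AffineDeformation K}
    (h : IsRegularDeformation d.A d.a) : UniquelyRecovered d := by
  have hindep := @eq_zero_of_smul_add_smul_eq_zero _ _ _ _ h.isUnit_cross
  have ha : d.a ≠ 0 := fun h0 => one_ne_zero (hindep (p := 1) (q := 0) (by simp [h0])).1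
  have hca : (d.comp d).a ≠ 0 := fun h0 =>
    one_ne_zero (hindep (p := 1) (q := 1) (by simpa [add_comm, AffineDeformation.comp] using h0)).1
  have hcA : IsUnit (d.comp d).A.det := by
    rw [AffineDeformation.comp, det_mul]
    exact h.isUnit_det.mul h.isUnit_det
  refine ⟨isEssentialMatrix_iff h.isUnit_det ha, isEssentialMatrix_iff hcA hca, ?_⟩
  intro A₀ a₀ C₀ c₀ hE₁₂ hE₁₃
  obtain ⟨α, v₁, hα, haα, hAα⟩ := exists_factorization h.isUnit_det ha hE₁₂
  obtain ⟨γ, v₃, hγ, hcγ, hCγ⟩ := exists_factorization hcA hca hE₁₃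
  have hcomp : (d.comp d).A = d.A ^ 2 := (pow_two _).symm
  -- Needed for the coordinate ring, to get the dimension, and for `K` itself, to get the single
  -- point.
  have huniq : ∀ {R : Type _} [CommRing R] [Algebra K R] (r : Unknown → R),
      (∀ f ∈ RepeatedSystem.equations A₀ a₀ C₀ c₀, MvPolynomial.aeval r f = 0) →
        r = fun i => algebraMap K R (Unknown.point α γ α⁻¹ γ⁻¹ v₁ v₃ i) := by
    intro R _ _ r hr
    obtain ⟨h₁, h₂, h₃, h₄⟩ := (RepeatedSystem.forall_aeval_eq_zero_iff _ _ _ _ r).1 hr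
    obtain ⟨e₁, e₂, e₃, e₄, e₅, e₆⟩ := (h.map (algebraMap K R)).solution_unique
      (α := algebraMap K R α) (γ := algebraMap K R γ) (x := algebraMap K R α⁻¹)
      (z := algebraMap K R γ⁻¹) (v₁ := algebraMap K R ∘ v₁) (v₃ := algebraMap K R ∘ v₃)
      (by
        ext i
        simpa using congrArg (algebraMap K R) (congrFun haα i))
      (by
        rw [← Matrix.map_add_vecMulVec, ← hAα]
        ext i j
        simp)
      (by
        ext i
        simpa [mulVec, dotProduct, AffineDeformation.comp] using
          congrArg (algebraMap K R) (congrFun hcγ i))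
      (by
        rw [← Matrix.map_add_vecMulVec, ← hCγ, hcomp]
        ext i j
        simp [pow_two, Matrix.mul_apply])
      (by rw [← map_mul, mul_inv_cancel₀ hα, map_one])
      (by rw [← map_mul, mul_inv_cancel₀ hγ, map_one]) h₁ h₂ h₃ h₄
    ext (_ | _ | _ | _ | i | i)
    exacts [e₁, e₂, e₃, e₄, congrFun e₅ i, congrFun e₆ i]
  have hmem : Unknown.point α γ α⁻¹ γ⁻¹ v₁ v₃ ∈ RepeatedSystem.solutions A₀ a₀ C₀ c₀ := by
    refine (RepeatedSystem.forall_aeval_eq_zero_iff A₀ a₀ C₀ c₀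
      (Unknown.point α γ α⁻¹ γ⁻¹ v₁ v₃)).2 ⟨?_, ?_, mul_inv_cancel₀ hα, mul_inv_cancel₀ hγ⟩
    · change (A₀ + vecMulVec a₀ v₁) *ᵥ a₀ + α • a₀ - γ • c₀ = 0
      rw [← hAα, ← hcγ, smul_mulVec, ← mulVec_smul, ← haα]
      exact sub_self _
    · change γ • (A₀ + vecMulVec a₀ v₁) ^ 2 - α ^ 2 • (C₀ + vecMulVec c₀ v₃) = 0
      rw [← hAα, ← hCγ, hcomp, smul_pow, smul_comm, sub_self]
  refine ⟨RepeatedSystem.ringKrullDim_coordinateRing_eq_zero hmem fun r => huniq r,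
    _, Set.eq_singleton_iff_unique_mem.2 ⟨hmem, fun q hq => huniq q hq⟩, haα, ?_, hcγ, ?_⟩
  · exact (eq_inv_smul_iff₀ hα).2 hAα
  · exact (eq_inv_smul_iff₀ hγ).2 hCγ

/-! ### The exceptional hypersurface -/

/-- The polynomial on the space of deformations whose nonvanishing expresses regularity. -/
noncomputable def regularityPolynomial : MvPolynomial ((Fin 3 × Fin 3) ⊕ Fin 3) ℝ :=
  let A : Matrix (Fin 3) (Fin 3) (MvPolynomial ((Fin 3 × Fin 3) ⊕ Fin 3) ℝ) :=
    Matrix.of fun i j => MvPolynomial.X (.inl (i, j))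
  let a : Fin 3 → MvPolynomial ((Fin 3 × Fin 3) ⊕ Fin 3) ℝ := fun i => MvPolynomial.X (.inr i)
  A.det * (A ^ 2 - 1).det * crossProduct a (A *ᵥ a) 0

theorem aeval_regularityPolynomial {K : Type*} [Field K] [Algebra ℝ K] (d : AffineDeformation K) :
    MvPolynomial.aeval d.coords regularityPolynomial =
      d.A.det * (d.A ^ 2 - 1).det * crossProduct d.a (d.A *ᵥ d.a) 0 := by
  have hA : (MvPolynomial.aeval d.coords).mapMatrix
      (Matrix.of fun i j => MvPolynomial.X (R := ℝ) (.inl (i, j))) = d.A := by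
    ext i j
    simp [AffineDeformation.coords]
  rw [regularityPolynomial, map_mul, map_mul, AlgHom.map_det, AlgHom.map_det, map_sub, map_pow,
    map_one, hA]
  congr 1
  simp [cross_apply, mulVec, dotProduct, AffineDeformation.coords]

theorem isRegularDeformation_of_aeval_ne_zero {K : Type*} [Field K] [Algebra ℝ K]
    {d : AffineDeformation K} (h : MvPolynomial.aeval d.coords regularityPolynomial ≠ 0) :
    IsRegularDeformation d.A d.a := by
  rw [aeval_regularityPolynomial, mul_ne_zero_iff, mul_ne_zero_iff] at h
  exact ⟨h.1.1.isUnit, h.1.2.isUnit, h.2.isUnit⟩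

theorem regularityPolynomial_ne_zero : regularityPolynomial ≠ 0 := by
  intro h
  -- The eigenvalues avoid `0` and `±1`, and the last two differ, so the minor of `a` and `A a` is
  -- `3 - 2 = 1`.
  have e := aeval_regularityPolynomial (K := ℝ) ⟨diagonal ![2, 2, 3], ![0, 1, 1]⟩
  rw [h, map_zero, diagonal_pow, ← diagonal_one, diagonal_sub, det_diagonal, det_diagonal] at e
  norm_num [Fin.prod_univ_three, cross_apply, mulVec_diagonal, show ![(2 : ℝ), 2, 3] 2 = 3 from rfl,
    show ![(0 : ℝ), 1, 1] 2 = 1 from rfl] at e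

/-- There is a nonzero polynomial `f` on the 12-dimensional space of affine deformations such
that every deformation off the hypersurface `f = 0`, real or complex, is uniquely recovered. -/
theorem mainTheorem1 :
    ∃ f : MvPolynomial ((Fin 3 × Fin 3) ⊕ Fin 3) ℝ, f ≠ 0 ∧
      (∀ d : AffineDeformation ℝ, MvPolynomial.aeval d.coords f ≠ 0 → UniquelyRecovered d) ∧
      (∀ d : AffineDeformation ℂ, MvPolynomial.aeval d.coords f ≠ 0 → UniquelyRecovered d) :=
  ⟨regularityPolynomial, regularityPolynomial_ne_zero,
    fun _ h => (isRegularDeformation_of_aeval_ne_zero h).uniquelyRecovered,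
    fun _ h => (isRegularDeformation_of_aeval_ne_zero h).uniquelyRecovered⟩
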